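/- All logarithms are natural. For probability measures $P,Q$ on a measurable space and $\alpha\in(1,\infty)$ let $D_\alpha(P\|Q)=\frac{1}{\alpha-1}\log\int\left(\frac{dP}{dQ}\right)^{\alpha}dQ$ if $P\ll Q$, and $D_\alpha(P\|Q)=\infty$ otherwise. Let $\xi,\rho\ge 0$. A randomized mechanism $M:\mathcal X^n\to\mathcal Y$ (a Markov kernel; $M(x)$ also denotes the law of the output on input $x$) is $(\xi,\rho)$-zCDP if $D_\alpha(M(x)\|M(x'))\le \xi+\rho\alpha$ for all $\alpha\in(1,\infty)$ and all $x,x'\in\mathcal X^n$ that differ in a single entry. For a random input $X$ in $\mathcal X^n$, $I(X;M(X))$ is the mutual information (in nats), that is, the Kullback–Leibler divergence of the joint law of $(X,M(X))$ from the product of its marginals, where $M(X)$ has conditional law $M(x)$ given $X=x$. Terms with a factor $k(1+\log k)$ are read as $0$ for $k=0$. **Theorem 6.3.** Let $m,\ell$ be nonnegative integers, $n=m\ell$, let $M:\mathcal X^n\to\mathcal Y$ be $(\xi,\rho)$-zCDP, let $X^1,\dots,X^m$ be independent random variables in $\mathcal X^\ell$, and let $X=(X^1,\dots,X^m)\in\mathcal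 X^n$ be their concatenation. Then $$I(X;M(X))\le m\left(\xi\,\ell(1+\log \ell)+\rho\,\ell^2\right).$$ In particular, for every $n$ and every $(\xi,\rho)$-zCDP mechanism $M:\mathcal X^n\to\mathcal Y$: 1. for every random variable $X$ in $\mathcal X^n$, with no independence assumed, $I(X;M(X))\le \xi\,n(1+\log n)+\rho n^2$, which is $\rho n^2$ if $\xi=0$; 2. if the entries of $X$ are independent, then $I(X;M(X))\le(\xi+\rho)n$, which is $\rho n$ if $\xi=0$. -/

import Mathlib

open MeasureTheory ProbabilityTheory InformationTheory
open scoped ENNReal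

noncomputable section

open scoped Classical in
/-- Rényi divergence of order `α ∈ (1, ∞)` between two probability measures, in nats:
`(α - 1)⁻¹ * log (E_{y ∼ Q} [(dP/dQ (y)) ^ α])` if `P ≪ Q`, and `∞` otherwise.
The integral and its logarithm take the value `∞` where the expectation diverges. -/
def renyiDiv {𝒴 : Type*} [MeasurableSpace 𝒴] (α : ℝ) (P Q : Measure 𝒴) : EReal :=
  if P ≪ Q then
    (((α - 1)⁻¹ : ℝ) : EReal) * ENNReal.log (∫⁻ y, (P.rnDeriv Q y) ^ α ∂Q)
  else ⊤

/-- A randomised mechanism `M : 𝒳ⁿ → 𝒴` (a kernel: `M x` is the law of the output on the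
dataset `x`) is `(ξ, ρ)`-zero-concentrated differentially private if
`D_α(M x ‖ M x') ≤ ξ + ρ α` for all `α ∈ (1, ∞)` and all datasets `x`, `x'` that differ in
a single entry. -/
def IsZCDP {𝒳 𝒴 : Type*} [MeasurableSpace 𝒳] [MeasurableSpace 𝒴] {n : ℕ} (ξ ρ : ℝ)
    (M : Kernel (Fin n → 𝒳) 𝒴) : Prop :=
  ∀ x x' : Fin n → 𝒳, (∃! i, x i ≠ x' i) →
    ∀ α : ℝ, 1 < α → renyiDiv α (M x) (M x') ≤ ((ξ + ρ * α : ℝ) : EReal)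

/-- Mutual information (in nats) between the two components of a random pair with law `π`:
the Kullback-Leibler divergence from the product of the marginals to the joint law. -/
def mutualInfo {α β : Type*} [MeasurableSpace α] [MeasurableSpace β]
    (π : Measure (α × β)) : ℝ≥0∞ :=
  klDiv π (π.fst.prod π.snd)

/-- `I(X; M(X))`, for a random input `X` on the probability space `(Ω, P)`. The pair
`(X, M(X))` has law `(P.map X) ⊗ₘ M`: given `X = x`, the output has law `M x`. -/
def mutualInfoOutput {Ω α β : Type*} [MeasurableSpace Ω] [MeasurableSpace α]
    [MeasurableSpace β] (P : Measure Ω) (X : Ω → α) (M : Kernel α β) : ℝ≥0∞ :=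
  mutualInfo ((P.map X) ⊗ₘ M)

/-- Concatenation of `m` blocks of length `ℓ` into one tuple of length `m * ℓ`; entry `j` of
the result is entry `j % ℓ` of block `j / ℓ`. -/
def concatBlocks {𝒳 : Type*} {m ℓ : ℕ} (x : Fin m → Fin ℓ → 𝒳) : Fin (m * ℓ) → 𝒳 :=
  fun j => x j.divNat j.modNat

end

/-!
All divergence bounds are carried in the dual form of Donsker and Varadhan:
`∫ f dμ ≤ C + log ∫ exp f dν` for all bounded measurable `f`. Densities appear only where this
form is compared with `klDiv` and with the Rényi divergence, always for a single pair of measures,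
so the input and output spaces may be arbitrary measurable spaces.

Group privacy. Testing a bound for `(μ, τ)` on `t/(1+t) * f` and applying Hölder's inequality to
the change of measure from `τ` to `ν` gives `KL(μ ‖ ν) ≤ (1 + 1/t) KL(μ ‖ τ) + D_{1+t}(τ ‖ ν)`
(`DonskerVaradhanLE.trans_renyiDiv`). With `t = k` the bounds `a k` for datasets at distance `k`
satisfy `a (k+1) / (k+1) ≤ a k / k + ξ / (k+1) + ρ`, whence `a k = k (ξ Hₖ + ρ k)`, and
`Hₖ ≤ 1 + log k` (`IsZCDP.donskerVaradhanLE`).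

Mutual information. If changing one of several independent inputs moves the output law by at most
`C`, then that input contributes at most `C`, by convexity and the chain rule
(`MutualInfoLE.prod`); induction over the inputs gives `m * C` for `m` blocks
(`MutualInfoLE.pi`). Finally, truncated log-likelihood ratios as test functions turn the dual bound
into a bound on `klDiv` (`DonskerVaradhanLE.klDiv_le`). An arbitrary input is one block of length
`n`, and an input with independent entries is `n` blocks of length one.
-/

section

/-! ### The Donsker–Varadhan inequality as a predicate -/

/-- `DonskerVaradhanLE C μ ν` says that `∫ f dμ - log ∫ exp f dν ≤ C` for all bounded
measurable `f`. By the Donsker–Varadhan formula this is `KL(μ ‖ ν) ≤ C`, for probability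
measures; only the implication `DonskerVaradhanLE.klDiv_le` is needed. -/
def DonskerVaradhanLE {α : Type*} [MeasurableSpace α] (C : ℝ) (μ ν : Measure α) : Prop :=
  ∀ f : α → ℝ, Measurable f → (∃ B, ∀ x, |f x| ≤ B) →
    ∫ x, f x ∂μ ≤ C + Real.log (∫ x, Real.exp (f x) ∂ν)

variable {α β γ : Type*} [MeasurableSpace α] [MeasurableSpace β] [MeasurableSpace γ]

lemma integrable_of_abs_le {μ : Measure α} [IsFiniteMeasure μ] {f : α → ℝ} (hf : Measurable f)
    {B : ℝ} (hB : ∀ x, |f x| ≤ B) : Integrable f μ :=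
  Integrable.of_bound hf.aestronglyMeasurable B (.of_forall hB)

lemma integrable_exp_of_abs_le {μ : Measure α} [IsFiniteMeasure μ] {f : α → ℝ}
    (hf : Measurable f) {B : ℝ} (hB : ∀ x, |f x| ≤ B) :
    Integrable (fun x => Real.exp (f x)) μ :=
  integrable_of_abs_le (by fun_prop) (B := Real.exp B) fun x => by
    rw [Real.abs_exp]
    exact Real.exp_le_exp.2 ((le_abs_self _).trans (hB x))

lemma exp_neg_le_integral_exp {μ : Measure α} [IsProbabilityMeasure μ] {f : α → ℝ}
    (hf : Measurable f) {B : ℝ} (hB : ∀ x, |f x| ≤ B) :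
    Real.exp (-B) ≤ ∫ x, Real.exp (f x) ∂μ := by
  have h := integral_mono (μ := μ) (integrable_const (Real.exp (-B)))
    (integrable_exp_of_abs_le hf hB) fun x => Real.exp_le_exp.2 (neg_le_of_abs_le (hB x))
  simpa using h

lemma integral_exp_pos_of_abs_le {μ : Measure α} [IsProbabilityMeasure μ] {f : α → ℝ}
    (hf : Measurable f) {B : ℝ} (hB : ∀ x, |f x| ≤ B) : 0 < ∫ x, Real.exp (f x) ∂μ :=
  (Real.exp_pos _).trans_le (exp_neg_le_integral_exp hf hB)

lemma abs_log_integral_exp_le {μ : Measure α} [IsProbabilityMeasure μ] {f : α → ℝ}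
    (hf : Measurable f) {B : ℝ} (hB : ∀ x, |f x| ≤ B) :
    |Real.log (∫ x, Real.exp (f x) ∂μ)| ≤ B := by
  have hpos := integral_exp_pos_of_abs_le (μ := μ) hf hB
  rw [abs_le]
  refine ⟨(Real.le_log_iff_exp_le hpos).2 (exp_neg_le_integral_exp hf hB),
    (Real.log_le_iff_le_exp hpos).2 ?_⟩
  have h := integral_mono (μ := μ) (integrable_exp_of_abs_le hf hB)
    (integrable_const (Real.exp B)) fun x => Real.exp_le_exp.2 (le_of_abs_le (hB x))
  simpa using h

/-- The conditional log-partition function of `f` along the kernel `κ` is an admissible test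
function. -/
lemma exists_exp_eq_integral_exp (κ : Kernel α β) [IsMarkovKernel κ] {f : α × β → ℝ}
    (hf : Measurable f) {B : ℝ} (hB : ∀ p, |f p| ≤ B) :
    ∃ h : α → ℝ, Measurable h ∧ (∀ a, |h a| ≤ B) ∧
      (∀ a, h a = Real.log (∫ b, Real.exp (f (a, b)) ∂κ a)) ∧
      ∀ a, Real.exp (h a) = ∫ b, Real.exp (f (a, b)) ∂κ a :=
  ⟨fun a => Real.log (∫ b, Real.exp (f (a, b)) ∂κ a),
    (StronglyMeasurable.integral_kernel_prod_right'
      (f := fun p => Real.exp (f p)) (by fun_prop)).measurable.log,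
    fun a => abs_log_integral_exp_le (by fun_prop) fun b => hB (a, b), fun _ => rfl,
    fun a => Real.exp_log (integral_exp_pos_of_abs_le (by fun_prop) fun b => hB (a, b))⟩

namespace DonskerVaradhanLE

lemma mono {C D : ℝ} {μ ν : Measure α} (h : DonskerVaradhanLE C μ ν) (hCD : C ≤ D) :
    DonskerVaradhanLE D μ ν := fun f hf hB => (h f hf hB).trans (by gcongr)

/-- Jensen's inequality. -/
lemma refl (μ : Measure α) [IsProbabilityMeasure μ] : DonskerVaradhanLE 0 μ μ := by
  rintro f hf ⟨B, hB⟩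
  rw [zero_add, Real.le_log_iff_exp_le (integral_exp_pos_of_abs_le hf hB)]
  exact convexOn_exp.map_integral_le Real.continuous_exp.continuousOn isClosed_univ
    (.of_forall fun _ => Set.mem_univ _) (integrable_of_abs_le hf hB)
    (integrable_exp_of_abs_le hf hB)

/-- Data processing. -/
lemma map {C : ℝ} {μ ν : Measure α} (h : DonskerVaradhanLE C μ ν) {g : α → β}
    (hg : Measurable g) : DonskerVaradhanLE C (μ.map g) (ν.map g) := by
  rintro f hf ⟨B, hB⟩
  rw [integral_map hg.aemeasurable hf.aestronglyMeasurable,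
    integral_map hg.aemeasurable (by fun_prop)]
  exact h _ (hf.comp hg) ⟨B, fun x => hB _⟩

/-- A bound that holds uniformly for two kernels passes to their composition-products with a
common law of the parameter. -/
lemma compProd {C : ℝ} {κ η : Kernel α β} [IsMarkovKernel κ] [IsMarkovKernel η] (μ : Measure α)
    [IsProbabilityMeasure μ] (h : ∀ a, DonskerVaradhanLE C (κ a) (η a)) :
    DonskerVaradhanLE C (μ ⊗ₘ κ) (μ ⊗ₘ η) := by
  rintro f hf ⟨B, hB⟩
  obtain ⟨h', hm, hb, hlog, hexp⟩ := exists_exp_eq_integral_exp η hf hB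
  rw [Measure.integral_compProd (integrable_of_abs_le hf hB),
    Measure.integral_compProd (integrable_exp_of_abs_le hf hB)]
  have h₁ : ∫ a, ∫ b, f (a, b) ∂κ a ∂μ
      ≤ ∫ a, (C + h' a) ∂μ :=
    integral_mono (Integrable.integral_compProd (κ := Kernel.const Unit μ)
      (η := Kernel.prodMkLeft Unit κ) (a := ()) (integrable_of_abs_le hf hB))
      ((integrable_const _).add (integrable_of_abs_le hm hb))
      fun a => hlog a ▸ h a _ (by fun_prop) ⟨B, fun b => hB (a, b)⟩
  rw [integral_add (integrable_const _) (integrable_of_abs_le hm hb)] at h₁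
  have h₂ := refl μ _ hm ⟨B, hb⟩
  simp only [hexp] at h₂
  simp only [integral_const, probReal_univ, one_smul] at h₁
  linarith

/-- The chain rule: with `h a = log ∫ exp f(a, b) dκ(a)`, the first hypothesis is applied to `h`
and the second to `f - h`, whose exponential has integral `1`. -/
lemma chain {C D : ℝ} {L : Measure (α × β)} [IsProbabilityMeasure L] {K : Measure α}
    [IsProbabilityMeasure K] {κ : Kernel α β} [IsMarkovKernel κ]
    (h₁ : DonskerVaradhanLE C L.fst K) (h₂ : DonskerVaradhanLE D L (L.fst ⊗ₘ κ)) :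
    DonskerVaradhanLE (C + D) L (K ⊗ₘ κ) := by
  rintro f hf ⟨B, hB⟩
  obtain ⟨h, hm, hb, -, he⟩ := exists_exp_eq_integral_exp κ hf hB
  have hgB (p : α × β) : |f p - h p.1| ≤ B + B := (abs_sub _ _).trans (add_le_add (hB p) (hb p.1))
  have hgm : Measurable fun p : α × β => f p - h p.1 := hf.sub (hm.comp measurable_fst)
  have H₁ := h₁ h hm ⟨B, hb⟩
  have H₂ := h₂ _ hgm ⟨_, hgB⟩
  rw [Measure.integral_compProd (integrable_exp_of_abs_le hgm hgB)] at H₂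
  have h1 (a : α) : ∫ b, Real.exp (f (a, b) - h a) ∂κ a = 1 := by
    simp_rw [Real.exp_sub, integral_div]
    rw [← he a]
    exact div_self (Real.exp_ne_zero _)
  simp only [h1, integral_const, probReal_univ, one_smul, Real.log_one, add_zero] at H₂
  rw [integral_sub (integrable_of_abs_le hf hB)
    (integrable_of_abs_le (by fun_prop) fun p => hb p.1)] at H₂
  rw [Measure.fst, integral_map measurable_fst.aemeasurable hm.aestronglyMeasurable] at H₁
  rw [Measure.integral_compProd (integrable_exp_of_abs_le hf hB)]
  simp only [he] at H₁
  linarith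

lemma absolutelyContinuous {C : ℝ} {μ ν : Measure α} [IsProbabilityMeasure μ]
    [IsProbabilityMeasure ν] (h : DonskerVaradhanLE C μ ν) : μ ≪ ν := by
  refine Measure.AbsolutelyContinuous.mk fun s hs hνs => ?_
  have key (n : ℕ) : n * μ.real s ≤ C := by
    -- the test function `n * 1_s` vanishes `ν`-almost everywhere
    have := h (s.indicator fun _ => (n : ℝ)) (measurable_const.indicator hs)
      ⟨n, fun x => by by_cases hx : x ∈ s <;> simp [hx]⟩
    have h0 : (fun x => Real.exp (s.indicator (fun _ => (n : ℝ)) x)) =ᵐ[ν] fun _ => 1 := by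
      have : ∀ᵐ x ∂ν, x ∉ s := measure_eq_zero_iff_ae_notMem.1 hνs
      filter_upwards [this] with x hx
      simp [hx]
    rw [integral_congr_ae h0, integral_indicator_const _ hs] at this
    simpa [mul_comm] using this
  by_contra hne
  have hpos : 0 < μ.real s := ENNReal.toReal_pos hne (measure_ne_top _ _)
  obtain ⟨n, hn⟩ := exists_nat_gt (C / μ.real s)
  rw [div_lt_iff₀ hpos] at hn
  exact absurd (key n) (not_le.2 hn)

end DonskerVaradhanLE

/-! ### From the Donsker–Varadhan inequality to the Kullback–Leibler divergence -/

/-- The truncation of `g ≥ 0` to `[exp (-n), exp n]`, whose logarithm is a bounded test function. -/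
noncomputable def expClamp (n : ℕ) (g : ℝ) : ℝ := max (Real.exp (-n)) (min (Real.exp n) g)

lemma expClamp_pos (n : ℕ) (g : ℝ) : 0 < expClamp n g :=
  (Real.exp_pos _).trans_le (le_max_left _ _)

lemma abs_log_expClamp_le (n : ℕ) (g : ℝ) : |Real.log (expClamp n g)| ≤ n := by
  rw [abs_le, Real.le_log_iff_exp_le (expClamp_pos n g), Real.log_le_iff_le_exp (expClamp_pos n g)]
  refine ⟨le_max_left _ _, max_le (Real.exp_le_exp.2 ?_) (min_le_left _ _)⟩
  linarith [Nat.cast_nonneg (α := ℝ) n]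

@[fun_prop]
lemma measurable_expClamp (n : ℕ) : Measurable (expClamp n) := by
  unfold expClamp
  fun_prop

/-- The truncated integrand of the Kullback–Leibler divergence is nonnegative, so that Fatou's
lemma applies. -/
lemma mul_log_expClamp_nonneg (n : ℕ) {g : ℝ} :
    0 ≤ g * Real.log (expClamp n g) - expClamp n g + 1 := by
  have hn : (0 : ℝ) ≤ n := Nat.cast_nonneg n
  set h := expClamp n g with hh
  have hpos : 0 < h := expClamp_pos n g
  have key : 0 ≤ h * Real.log h + 1 - h := klFun_nonneg hpos.le
  suffices 0 ≤ (g - h) * Real.log h by linarith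
  rcases le_total g (Real.exp n) with h1 | h1
  · rcases le_total g (Real.exp (-n)) with h2 | h2
    · have : h = Real.exp (-n) := by rw [hh, expClamp, min_eq_right h1, max_eq_left h2]
      rw [this, Real.log_exp]
      nlinarith
    · have : h = g := by rw [hh, expClamp, min_eq_right h1, max_eq_right h2]
      simp [this]
  · have : h = Real.exp n := by
      rw [hh, expClamp, min_eq_left h1, max_eq_right (Real.exp_le_exp.2 (by linarith))]
    rw [this, Real.log_exp]
    exact mul_nonneg (by linarith) hn

lemma tendsto_mul_log_expClamp {g : ℝ} (hg : 0 ≤ g) :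
    Filter.Tendsto (fun n : ℕ => g * Real.log (expClamp n g) - expClamp n g + 1) Filter.atTop
      (nhds (klFun g)) := by
  have hneg : Filter.Tendsto (fun n : ℕ => Real.exp (-(n : ℝ))) Filter.atTop (nhds 0) :=
    Real.tendsto_exp_neg_atTop_nhds_zero.comp tendsto_natCast_atTop_atTop
  have hpos : Filter.Tendsto (fun n : ℕ => Real.exp (n : ℝ)) Filter.atTop Filter.atTop :=
    Real.tendsto_exp_atTop.comp tendsto_natCast_atTop_atTop
  rcases hg.eq_or_lt with rfl | hg
  · have : ∀ n : ℕ, expClamp n 0 = Real.exp (-(n : ℝ)) := fun n => by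
      rw [expClamp, min_eq_right (Real.exp_pos _).le, max_eq_left (Real.exp_pos _).le]
    simp only [this, zero_mul, zero_sub, klFun_zero]
    simpa using hneg.neg.add_const 1
  · have : ∀ᶠ n : ℕ in Filter.atTop, expClamp n g = g := by
      filter_upwards [hneg.eventually_le_const hg, hpos.eventually_ge_atTop g] with n h1 h2
      rw [expClamp, min_eq_right h2, max_eq_right h1]
    refine tendsto_const_nhds.congr' ?_
    filter_upwards [this] with n hn
    rw [hn, klFun]
    ring

/-- Test functions: the truncated log-likelihood ratios. -/
theorem DonskerVaradhanLE.klDiv_le {C : ℝ} {μ ν : Measure α} [IsProbabilityMeasure μ]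
    [IsProbabilityMeasure ν] (h : DonskerVaradhanLE C μ ν) : klDiv μ ν ≤ ENNReal.ofReal C := by
  have hac := h.absolutelyContinuous
  set g : α → ℝ := fun x => (μ.rnDeriv ν x).toReal with hg
  have hgm : Measurable g := (Measure.measurable_rnDeriv μ ν).ennreal_toReal
  have hg0 (x : α) : 0 ≤ g x := ENNReal.toReal_nonneg
  set F : ℕ → α → ℝ := fun n x => g x * Real.log (expClamp n (g x)) - expClamp n (g x) + 1
  have hFm (n : ℕ) : Measurable (F n) := by fun_prop
  have hF (n : ℕ) : ∫⁻ x, ENNReal.ofReal (F n x) ∂ν ≤ ENNReal.ofReal C := by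
    have hf : Measurable fun x => Real.log (expClamp n (g x)) := by fun_prop
    have hb (x : α) := abs_log_expClamp_le n (g x)
    have hexp (x : α) : Real.exp (Real.log (expClamp n (g x))) = expClamp n (g x) :=
      Real.exp_log (expClamp_pos _ _)
    have i₁ : Integrable (fun x => g x * Real.log (expClamp n (g x))) ν := by
      simpa [hg] using (integrable_rnDeriv_smul_iff hac).2 (integrable_of_abs_le (μ := μ) hf hb)
    have i₂ : Integrable (fun x => expClamp n (g x)) ν := by
      simpa only [hexp] using integrable_exp_of_abs_le (μ := ν) hf hb
    have e₁ : ∫ x, g x * Real.log (expClamp n (g x)) ∂ν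
        = ∫ x, Real.log (expClamp n (g x)) ∂μ := by
      simpa [hg] using integral_rnDeriv_smul (f := fun x => Real.log (expClamp n (g x))) hac
    have hpos := integral_exp_pos_of_abs_le (μ := ν) hf hb
    have hDV := h _ hf ⟨n, hb⟩
    simp only [hexp] at hpos hDV
    rw [← ofReal_integral_eq_lintegral_ofReal (f := F n) ((i₁.sub i₂).add (integrable_const 1))
      (.of_forall fun _ => mul_log_expClamp_nonneg n)]
    refine ENNReal.ofReal_le_ofReal ?_
    simp only [F]
    rw [integral_add (by exact i₁.sub i₂) (integrable_const _), integral_sub i₁ i₂, e₁]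
    simp only [integral_const, probReal_univ, one_smul]
    linarith [Real.log_le_sub_one_of_pos hpos]
  rw [klDiv_eq_lintegral_klFun_of_ac hac]
  calc ∫⁻ x, ENNReal.ofReal (klFun (g x)) ∂ν
      = ∫⁻ x, Filter.liminf (fun n => ENNReal.ofReal (F n x)) Filter.atTop ∂ν :=
        lintegral_congr fun x =>
          ((ENNReal.continuous_ofReal.tendsto _).comp
            (tendsto_mul_log_expClamp (hg0 x))).liminf_eq.symm
    _ ≤ Filter.liminf (fun n => ∫⁻ x, ENNReal.ofReal (F n x) ∂ν) Filter.atTop :=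
        lintegral_liminf_le fun n => (hFm n).ennreal_ofReal
    _ ≤ ENNReal.ofReal C :=
        Filter.liminf_le_of_le (by isBoundedDefault) fun b hb => by
          obtain ⟨n, hn⟩ := hb.exists
          exact hn.trans (hF n)

/-! ### Rényi divergence and group privacy -/

lemma lintegral_rnDeriv_rpow_le_of_renyiDiv_le {τ ν : Measure α} {a c : ℝ} (ha : 1 < a)
    (h : renyiDiv a τ ν ≤ (c : EReal)) :
    τ ≪ ν ∧ ∫⁻ x, (τ.rnDeriv ν x) ^ a ∂ν ≤ ENNReal.ofReal (Real.exp ((a - 1) * c)) := by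
  have hac : τ ≪ ν := by
    by_contra hn
    rw [renyiDiv, if_neg hn, top_le_iff] at h
    exact EReal.coe_ne_top _ h
  rw [renyiDiv, if_pos hac] at h
  refine ⟨hac, ?_⟩
  have ha' : 0 < a - 1 := by linarith
  rw [← ENNReal.log_le_log_iff, ENNReal.log_ofReal_of_pos (Real.exp_pos _), Real.log_exp]
  have := mul_le_mul_of_nonneg_left h (a := ((a - 1 : ℝ) : EReal)) (by exact_mod_cast ha'.le)
  rwa [← mul_assoc, ← EReal.coe_mul, mul_inv_cancel₀ ha'.ne', EReal.coe_one, one_mul,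
    ← EReal.coe_mul] at this

/-- The weak triangle inequality `KL(μ ‖ ν) ≤ (1 + 1/t) KL(μ ‖ τ) + D_{1+t}(τ ‖ ν)`. The first
hypothesis is applied to `t/(1+t) * f`, and Hölder's inequality with exponents `(1+t)/t` and `1+t`
bounds `∫ exp (t/(1+t) * f) dτ`. -/
lemma DonskerVaradhanLE.trans_renyiDiv {μ τ ν : Measure α} [IsProbabilityMeasure τ]
    [IsProbabilityMeasure ν] {C D t : ℝ} (ht : 0 < t) (h : DonskerVaradhanLE C μ τ)
    (hD : renyiDiv (1 + t) τ ν ≤ (D : EReal)) :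
    DonskerVaradhanLE ((1 + 1 / t) * C + D) μ ν := by
  rintro f hf ⟨B, hB⟩
  obtain ⟨hac, hint⟩ := lintegral_rnDeriv_rpow_le_of_renyiDiv_le (by linarith) hD
  have h1t : 0 < 1 + t := by linarith
  set l : ℝ := t / (1 + t) with hl
  have hl0 : 0 < l := div_pos ht h1t
  have hlB (x : α) : |l * f x| ≤ l * B := by
    rw [abs_mul, abs_of_pos hl0]
    gcongr
    exact hB x
  have hlf : Measurable fun x => l * f x := by fun_prop
  have key := h _ hlf ⟨_, hlB⟩
  have hposν := integral_exp_pos_of_abs_le (μ := ν) hf hB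
  have hposτ := integral_exp_pos_of_abs_le (μ := τ) hlf hlB
  have hpq : (l⁻¹).HolderConjugate (1 + t) := by
    rw [Real.holderConjugate_iff]
    refine ⟨(one_lt_inv₀ hl0).2 ((div_lt_one h1t).2 (by linarith)), ?_⟩
    rw [hl]
    field_simp
    ring
  have holder : ∫ x, Real.exp (l * f x) ∂τ
      ≤ (∫ x, Real.exp (f x) ∂ν) ^ l * Real.exp (t * D) ^ (1 / (1 + t)) := by
    rw [← ENNReal.ofReal_le_ofReal_iff (by positivity),
      ofReal_integral_eq_lintegral_ofReal (integrable_exp_of_abs_le hlf hlB)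
        (.of_forall fun _ => (Real.exp_pos _).le),
      ENNReal.ofReal_mul (by positivity), ← ENNReal.ofReal_rpow_of_pos hposν,
      ← ENNReal.ofReal_rpow_of_pos (Real.exp_pos _),
      ofReal_integral_eq_lintegral_ofReal (integrable_exp_of_abs_le hf hB)
        (.of_forall fun _ => (Real.exp_pos _).le)]
    rw [← lintegral_rnDeriv_mul hac (by fun_prop)]
    have := ENNReal.lintegral_mul_le_Lp_mul_Lq ν hpq
      (f := fun x => ENNReal.ofReal (Real.exp (l * f x))) (g := τ.rnDeriv ν) (by fun_prop)
      (by fun_prop)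
    have e (x : α) :
        ENNReal.ofReal (Real.exp (l * f x)) ^ l⁻¹ = ENNReal.ofReal (Real.exp (f x)) := by
      rw [ENNReal.ofReal_rpow_of_pos (Real.exp_pos _), ← Real.exp_mul, mul_comm l, mul_assoc,
        mul_inv_cancel₀ hl0.ne', mul_one]
    simp only [e, one_div, inv_inv, Pi.mul_apply] at this
    simp only [mul_comm (τ.rnDeriv ν _), one_div]
    refine this.trans ?_
    gcongr
    simpa using hint
  have hlog := Real.log_le_log hposτ holder
  rw [Real.log_mul (by positivity) (by positivity), Real.log_rpow hposν,
    Real.log_rpow (Real.exp_pos _), Real.log_exp] at hlog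
  rw [integral_const_mul] at key
  have hlD : 1 / (1 + t) * (t * D) = l * D := by rw [hl]; ring
  have hlC : l * ((1 + 1 / t) * C) = C := by
    rw [hl]
    field_simp
    ring
  refine le_of_mul_le_mul_left ?_ hl0
  rw [mul_add, mul_add, hlC]
  linarith

/-! ### Mutual information of a kernel with an input law -/

/-- `MutualInfoLE C μ N` bounds by `C` the divergence of the joint law of an input with law `μ` and
its output under `N` from the product of its marginals. -/
def MutualInfoLE (C : ℝ) (μ : Measure α) (N : Kernel α β) : Prop :=
  DonskerVaradhanLE C (μ ⊗ₘ N) (μ.prod (N ∘ₘ μ))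

namespace ProbabilityTheory.Kernel

/-- The kernel `N` with its first input averaged over `μ`. -/
noncomputable def averageFst (μ : Measure α)
    (N : Kernel (α × β) γ) : Kernel β γ :=
  (Kernel.const β μ ⊗ₖ N.comap Prod.swap measurable_swap).snd

instance (μ : Measure α) [IsProbabilityMeasure μ] (N : Kernel (α × β) γ) [IsMarkovKernel N] :
    IsMarkovKernel (N.averageFst μ) := by
  unfold averageFst
  infer_instance

lemma averageFst_apply (μ : Measure α) [IsProbabilityMeasure μ]
    (N : Kernel (α × β) γ) [IsMarkovKernel N] (b : β) :
    N.averageFst μ b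
      = (μ ⊗ₘ N.comap (fun a => (a, b)) (by fun_prop)).map Prod.snd := by
  rw [averageFst, Kernel.snd_apply, Kernel.compProd_apply_eq_compProd_sectR]
  rfl

lemma lintegral_averageFst (μ : Measure α) [IsProbabilityMeasure μ]
    (N : Kernel (α × β) γ) [IsMarkovKernel N] (b : β) {F : γ → ℝ≥0∞} (hF : Measurable F) :
    ∫⁻ c, F c ∂N.averageFst μ b = ∫⁻ a, ∫⁻ c, F c ∂N (a, b) ∂μ := by
  rw [averageFst_apply, MeasureTheory.lintegral_map hF measurable_snd,
    Measure.lintegral_compProd (by fun_prop)]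
  rfl

end ProbabilityTheory.Kernel

namespace MutualInfoLE

lemma const (μ : Measure α) [IsProbabilityMeasure μ] (ν : Measure β) [IsProbabilityMeasure ν] :
    MutualInfoLE 0 μ (Kernel.const α ν) := by
  rw [MutualInfoLE, Measure.compProd_const, Measure.const_comp, measure_univ, one_smul]
  exact .refl _

lemma of_comap {C : ℝ} {μ : Measure α} [IsProbabilityMeasure μ] {N : Kernel γ β}
    [IsMarkovKernel N] {g : α → γ} (hg : Measurable g) (h : MutualInfoLE C μ (N.comap g hg)) :
    MutualInfoLE C (μ.map g) N := by
  have : IsProbabilityMeasure (μ.map g) := Measure.isProbabilityMeasure_map hg.aemeasurable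
  have e₁ : (μ ⊗ₘ N.comap g hg).map (Prod.map g id) = μ.map g ⊗ₘ N := by
    refine Measure.ext_of_lintegral _ fun F hF => ?_
    rw [lintegral_map hF (by fun_prop), Measure.lintegral_compProd (by fun_prop),
      Measure.lintegral_compProd hF, lintegral_map hF.lintegral_kernel_prod_right' hg]
    rfl
  have e₂ : N.comap g hg ∘ₘ μ = N ∘ₘ μ.map g := by
    refine Measure.ext_of_lintegral _ fun F hF => ?_
    rw [Measure.lintegral_bind (by fun_prop) (by fun_prop),
      Measure.lintegral_bind (by fun_prop) (by fun_prop), lintegral_map hF.lintegral_kernel hg]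
    rfl
  have := DonskerVaradhanLE.map h (g := Prod.map g id) (by fun_prop)
  rwa [e₁, e₂, ← Measure.map_prod_map _ _ hg measurable_id, Measure.map_id] at this

/-- Adding an independent input `a ∼ μ` to `b ∼ ν` increases the mutual information by at most the
largest divergence caused by changing `a`. This is the chain rule, applied to the joint law of
`((b, output), a)`. -/
lemma prod {C D : ℝ} {μ : Measure α} [IsProbabilityMeasure μ] {ν : Measure β}
    [IsProbabilityMeasure ν] {N : Kernel (α × β) γ} [IsMarkovKernel N]
    (hC : ∀ a a' b, DonskerVaradhanLE C (N (a, b)) (N (a', b)))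
    (hD : MutualInfoLE D ν (N.averageFst μ)) :
    MutualInfoLE (D + C) (μ.prod ν) N := by
  set L : Measure ((β × γ) × α) :=
    ((μ.prod ν) ⊗ₘ N).map (fun p => ((p.1.2, p.2), p.1.1)) with hL
  have hLp : IsProbabilityMeasure L := Measure.isProbabilityMeasure_map (by fun_prop)
  have lintL {F : (β × γ) × α → ℝ≥0∞} (hF : Measurable F) :
      ∫⁻ p, F p ∂L = ∫⁻ a, ∫⁻ b, ∫⁻ c, F ((b, c), a) ∂N (a, b) ∂ν ∂μ := by
    have hF' : Measurable fun p : (α × β) × γ => F ((p.1.2, p.2), p.1.1) := by fun_prop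
    rw [hL, lintegral_map hF (by fun_prop), Measure.lintegral_compProd hF',
      lintegral_prod _ (hF'.lintegral_kernel_prod_right' (κ := N)).aemeasurable]
  have hfst : L.fst = ν ⊗ₘ N.averageFst μ := by
    refine Measure.ext_of_lintegral _ fun F hF => ?_
    have hF' : Measurable fun p : (α × β) × γ => F (p.1.2, p.2) := by fun_prop
    rw [Measure.fst, lintegral_map hF measurable_fst, lintL (by fun_prop),
      Measure.lintegral_compProd hF,
      lintegral_lintegral_swap (hF'.lintegral_kernel_prod_right' (κ := N)).aemeasurable]
    refine lintegral_congr fun b => ?_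
    rw [Kernel.lintegral_averageFst _ _ _ (by fun_prop)]
  have hbind : N.averageFst μ ∘ₘ ν = N ∘ₘ μ.prod ν := by
    rw [← Measure.snd_compProd, ← hfst, ← Measure.snd_compProd, Measure.fst, Measure.snd,
      Measure.snd, hL, Measure.map_map (by fun_prop) (by fun_prop),
      Measure.map_map (by fun_prop) (by fun_prop)]
    rfl
  -- comparison of outputs on `(a, b)` and `(a', b)`, with `a'` an independent copy of `a`
  have hstep : DonskerVaradhanLE C L (L.fst ⊗ₘ Kernel.const _ μ) := by
    set κ : Kernel (α × β × α) γ := N.comap (fun p => (p.1, p.2.1)) (by fun_prop) with hκ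
    set η : Kernel (α × β × α) γ := N.comap (fun p => (p.2.2, p.2.1)) (by fun_prop) with hη
    have h := (DonskerVaradhanLE.compProd (κ := κ) (η := η) (μ.prod (ν.prod μ))
      fun p => hC p.1 p.2.2 p.2.1).map (g := fun p => ((p.1.2.1, p.2), p.1.1)) (by fun_prop)
    have lint (θ : Kernel (α × β × α) γ) [IsMarkovKernel θ] {F : (β × γ) × α → ℝ≥0∞}
        (hF : Measurable F) :
        ∫⁻ p, F p ∂((μ.prod (ν.prod μ)) ⊗ₘ θ).map (fun p => ((p.1.2.1, p.2), p.1.1))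
          = ∫⁻ a, ∫⁻ b, ∫⁻ a', ∫⁻ c, F ((b, c), a) ∂θ (a, b, a') ∂μ ∂ν ∂μ := by
      have hF' : Measurable fun p : (α × β × α) × γ => F ((p.1.2.1, p.2), p.1.1) := by fun_prop
      have hF'' := hF'.lintegral_kernel_prod_right' (κ := θ)
      rw [lintegral_map hF (by fun_prop), Measure.lintegral_compProd hF',
        lintegral_prod _ hF''.aemeasurable]
      refine lintegral_congr fun a => ?_
      rw [lintegral_prod _ (by exact (hF''.comp (measurable_prodMk_left (x := a))).aemeasurable)]
    convert h using 1
    · refine Measure.ext_of_lintegral _ fun F hF => ?_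
      rw [lintL hF, lint κ hF]
      simp [hκ]
    · refine Measure.ext_of_lintegral _ fun F hF => ?_
      rw [lint η hF, Measure.compProd_const, lintegral_prod_symm _ hF.aemeasurable, hfst]
      refine lintegral_congr fun a => ?_
      rw [Measure.lintegral_compProd (by fun_prop)]
      refine lintegral_congr fun b => ?_
      rw [Kernel.lintegral_averageFst _ _ _ (by fun_prop)]
      simp [hη]
  rw [MutualInfoLE, ← hfst] at hD
  have h := (DonskerVaradhanLE.chain hD hstep).map
    (g := fun p => ((p.2, p.1.1), p.1.2)) (by fun_prop)
  rw [MutualInfoLE]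
  convert h using 1
  · rw [hL, Measure.map_map (by fun_prop) (by fun_prop)]
    exact Measure.map_id.symm
  · rw [hbind, Measure.compProd_const]
    refine Measure.ext_of_lintegral _ fun F hF => ?_
    have hF' : Measurable fun p : (β × γ) × α => F ((p.2, p.1.1), p.1.2) := by fun_prop
    rw [lintegral_map hF (by fun_prop), lintegral_prod _ hF.aemeasurable,
      lintegral_prod_symm _ hF'.aemeasurable,
      lintegral_prod _ hF.lintegral_prod_right'.aemeasurable]
    exact lintegral_congr fun a =>
      (lintegral_prod (fun q : β × γ => F ((a, q.1), q.2)) (by fun_prop)).symm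

end MutualInfoLE

lemma MutualInfoLE.pi {C : ℝ} {m : ℕ} (μ : Fin m → Measure α) [∀ i, IsProbabilityMeasure (μ i)]
    (N : Kernel (Fin m → α) β) [IsMarkovKernel N]
    (hN : ∀ i x z, DonskerVaradhanLE C (N x) (N (Function.update x i z))) :
    MutualInfoLE (m * C) (Measure.pi μ) N := by
  induction m with
  | zero =>
    have : N = Kernel.const _ (N default) := by
      ext x : 1
      rw [Subsingleton.elim x default, Kernel.const_apply]
    rw [this, Nat.cast_zero, zero_mul]
    exact .const _ _
  | succ m ih =>
    set e := MeasurableEquiv.piFinSuccAbove (fun _ : Fin (m + 1) => α) 0 with he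
    have hcons (a : α) (x : Fin m → α) : e.symm (a, x) = Fin.cons a x := by
      simp [he, MeasurableEquiv.piFinSuccAbove, Fin.insertNthEquiv]
    have hmap : ((μ 0).prod (Measure.pi fun j => μ (Fin.succ j))).map e.symm = Measure.pi μ :=
      ((measurePreserving_piFinSuccAbove μ 0).symm e).map_eq
    rw [← hmap]
    refine .of_comap e.symm.measurable ?_
    rw [Nat.cast_succ, add_mul, one_mul]
    refine .prod (fun a a' x => ?_) (ih _ _ fun i x z => ?_)
    · simpa [hcons] using hN 0 (Fin.cons a x) a'
    · rw [Kernel.averageFst_apply, Kernel.averageFst_apply]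
      refine (DonskerVaradhanLE.compProd _ fun a => ?_).map measurable_snd
      simpa [hcons, Fin.cons_update] using hN i.succ (Fin.cons a x) z

/-- The input is an arbitrary function `g` of `m` independent blocks, and `C` bounds the effect
on the output law of changing one block. -/
lemma mutualInfoOutput_le {Ω : Type*} [MeasurableSpace Ω] {P : Measure Ω} [IsProbabilityMeasure P]
    {C : ℝ} {m : ℕ} {X : Fin m → Ω → α} (hX : ∀ i, Measurable (X i)) (hind : iIndepFun X P)
    {g : (Fin m → α) → γ} (hg : Measurable g) (M : Kernel γ β) [IsMarkovKernel M]
    (hM : ∀ i x z, DonskerVaradhanLE C (M (g x)) (M (g (Function.update x i z)))) :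
    mutualInfoOutput P (fun ω => g fun i => X i ω) M ≤ ENNReal.ofReal (m * C) := by
  have hXi (i : Fin m) : IsProbabilityMeasure (P.map (X i)) :=
    Measure.isProbabilityMeasure_map (hX i).aemeasurable
  have hXm : Measurable fun ω i => X i ω := measurable_pi_lambda _ hX
  have h := (MutualInfoLE.pi (fun i => P.map (X i)) (M.comap g hg) hM).of_comap hg
  rw [← (iIndepFun_iff_map_fun_eq_pi_map fun i => (hX i).aemeasurable).1 hind,
    Measure.map_map hg hXm] at h
  change MutualInfoLE _ (P.map fun ω => g fun i => X i ω) M at h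
  have hp : IsProbabilityMeasure (P.map fun ω => g fun i => X i ω) :=
    Measure.isProbabilityMeasure_map (hg.comp hXm).aemeasurable
  rw [mutualInfoOutput, mutualInfo, Measure.fst_compProd, Measure.snd_compProd]
  exact DonskerVaradhanLE.klDiv_le h

/-! ### Group privacy -/

/-- One step of the group privacy induction. For `k ≥ 1` it is the weak triangle inequality with
`t = k`; for `k = 0` the order `1 + t` tends to `1`. -/
lemma DonskerVaradhanLE.succ_of_renyiDiv {ξ ρ : ℝ} (hρ : 0 ≤ ρ) {k : ℕ} {μ τ ν : Measure α}
    [IsProbabilityMeasure τ] [IsProbabilityMeasure ν]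
    (h : DonskerVaradhanLE (k * (ξ * harmonic k + ρ * k)) μ τ)
    (hD : ∀ a : ℝ, 1 < a → renyiDiv a τ ν ≤ ((ξ + ρ * a : ℝ) : EReal)) :
    DonskerVaradhanLE ((k + 1 : ℕ) * (ξ * harmonic (k + 1) + ρ * (k + 1 : ℕ))) μ ν := by
  rcases k.eq_zero_or_pos with rfl | hk
  · intro f hf hB
    refine le_of_forall_pos_le_add fun ε hε => ?_
    have ht : 0 < ε / (ρ + 1) := by positivity
    have := h.trans_renyiDiv ht (hD _ (by linarith)) f hf hB
    have hle : ρ * (ε / (ρ + 1)) ≤ ε := by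
      rw [mul_div_assoc', div_le_iff₀ (by positivity)]
      nlinarith
    simp [harmonic] at this ⊢
    linarith
  · have hk' : (0 : ℝ) < k := by exact_mod_cast hk
    refine (h.trans_renyiDiv hk' (hD _ (by linarith))).mono (le_of_eq ?_)
    rw [harmonic_succ]
    push_cast
    field_simp
    ring

/-- Group privacy, in the limit of order `1`: the bound `k (ξ Hₖ + ρ k)` for datasets that agree
off a set of `k` indices. -/
lemma IsZCDP.donskerVaradhanLE_harmonic {𝒳 : Type*} [MeasurableSpace 𝒳] {n : ℕ} {ξ ρ : ℝ}
    (hξ : 0 ≤ ξ) (hρ : 0 ≤ ρ) {M : Kernel (Fin n → 𝒳) β} [IsMarkovKernel M] (hM : IsZCDP ξ ρ M)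
    (s : Finset (Fin n)) (x x' : Fin n → 𝒳) (hs : ∀ i ∉ s, x i = x' i) :
    DonskerVaradhanLE (s.card * (ξ * harmonic s.card + ρ * s.card)) (M x) (M x') := by
  induction s using Finset.induction generalizing x' with
  | empty =>
    obtain rfl : x = x' := funext fun i => hs i (Finset.notMem_empty i)
    simpa using DonskerVaradhanLE.refl (M x)
  | insert j s hj ih =>
    rw [Finset.card_insert_of_notMem hj]
    have h := ih (Function.update x' j (x j)) fun i hi => by
      by_cases hij : i = j
      · subst hij
        simp
      · rw [Function.update_of_ne hij]
        exact hs i (by simp [hij, hi])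
    by_cases hxj : x j = x' j
    · rw [hxj, Function.update_eq_self] at h
      refine h.mono ?_
      have h0 : (0 : ℝ) ≤ harmonic s.card := by
        exact_mod_cast Finset.sum_nonneg fun i _ => by positivity
      rw [harmonic_succ]
      push_cast
      have : (0 : ℝ) ≤ ((s.card : ℝ) + 1)⁻¹ := by positivity
      gcongr <;> linarith
    · refine h.succ_of_renyiDiv hρ fun a ha => hM _ _ ⟨j, by simpa using hxj, fun i hi => ?_⟩ a ha
      by_contra hij
      simp [Function.update_of_ne hij] at hi

/-- Group privacy for datasets that agree off a set of `k` indices, with `Hₖ ≤ 1 + log k`. For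
`k = 0` the product `k * (1 + log k)` vanishes because `log 0 = 0`. -/
lemma IsZCDP.donskerVaradhanLE {𝒳 : Type*} [MeasurableSpace 𝒳] {n : ℕ} {ξ ρ : ℝ}
    (hξ : 0 ≤ ξ) (hρ : 0 ≤ ρ) {M : Kernel (Fin n → 𝒳) β} [IsMarkovKernel M] (hM : IsZCDP ξ ρ M)
    (s : Finset (Fin n)) (x x' : Fin n → 𝒳) (hs : ∀ i ∉ s, x i = x' i) :
    DonskerVaradhanLE (ξ * (s.card * (1 + Real.log s.card)) + ρ * (s.card : ℝ) ^ 2)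
      (M x) (M x') := by
  refine (hM.donskerVaradhanLE_harmonic hξ hρ s x x' hs).mono ?_
  have := mul_le_mul_of_nonneg_left (harmonic_le_one_add_log s.card)
    (mul_nonneg hξ (Nat.cast_nonneg (α := ℝ) s.card))
  nlinarith

/-! ### Mutual information of zCDP mechanisms -/

lemma measurable_concatBlocks {𝒳 : Type*} [MeasurableSpace 𝒳] {m ℓ : ℕ} :
    Measurable (concatBlocks : (Fin m → Fin ℓ → 𝒳) → Fin (m * ℓ) → 𝒳) := by
  unfold concatBlocks
  fun_prop

lemma concatBlocks_update_apply {𝒳 : Type*} {m ℓ : ℕ} (x : Fin m → Fin ℓ → 𝒳) (i : Fin m)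
    (z : Fin ℓ → 𝒳) {j : Fin (m * ℓ)}
    (hj : j ∉ Finset.univ.image fun k : Fin ℓ => finProdFinEquiv (i, k)) :
    concatBlocks x j = concatBlocks (Function.update x i z) j := by
  have : j.divNat ≠ i := by
    rintro rfl
    exact hj (Finset.mem_image.2 ⟨j.modNat, Finset.mem_univ _,
      finProdFinEquiv.apply_symm_apply j⟩)
  simp [concatBlocks, Function.update_of_ne this]

end

theorem theorem6p3 {𝒳 𝒴 Ω : Type*} [MeasurableSpace 𝒳] [MeasurableSpace 𝒴]
    [MeasurableSpace Ω] (P : Measure Ω) [IsProbabilityMeasure P]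
    (ξ ρ : ℝ) (hξ : 0 ≤ ξ) (hρ : 0 ≤ ρ) :
    -- `m` independent blocks of length `ℓ`, with `n = m * ℓ`
    (∀ (m ℓ : ℕ) (M : Kernel (Fin (m * ℓ) → 𝒳) 𝒴) [IsMarkovKernel M], IsZCDP ξ ρ M →
      ∀ X : Fin m → Ω → (Fin ℓ → 𝒳), (∀ i, Measurable (X i)) → iIndepFun X P →
        mutualInfoOutput P (fun ω => concatBlocks (fun i => X i ω)) M ≤
          ENNReal.ofReal (m * (ξ * (ℓ * (1 + Real.log ℓ)) + ρ * (ℓ : ℝ) ^ 2))) ∧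
    -- an arbitrary input
    (∀ (n : ℕ) (M : Kernel (Fin n → 𝒳) 𝒴) [IsMarkovKernel M], IsZCDP ξ ρ M →
      ∀ X : Ω → (Fin n → 𝒳), Measurable X →
        mutualInfoOutput P X M ≤
          ENNReal.ofReal (ξ * (n * (1 + Real.log n)) + ρ * (n : ℝ) ^ 2)) ∧
    -- an input with independent entries
    (∀ (n : ℕ) (M : Kernel (Fin n → 𝒳) 𝒴) [IsMarkovKernel M], IsZCDP ξ ρ M →
      ∀ X : Fin n → Ω → 𝒳, (∀ i, Measurable (X i)) → iIndepFun X P →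
        mutualInfoOutput P (fun ω i => X i ω) M ≤ ENNReal.ofReal ((ξ + ρ) * n)) := by
  refine ⟨fun m ℓ M _ hM X hX hind => ?_, fun n M _ hM X hX => ?_, fun n M _ hM X hX hind => ?_⟩
  · refine mutualInfoOutput_le hX hind measurable_concatBlocks M fun i x z => ?_
    have h := hM.donskerVaradhanLE hξ hρ _ (concatBlocks x)
      (concatBlocks (Function.update x i z)) fun j hj => concatBlocks_update_apply x i z hj
    have hinj : Function.Injective fun k : Fin ℓ => finProdFinEquiv (i, k) :=
      finProdFinEquiv.injective.comp (Prod.mk_right_injective i)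
    rwa [Finset.card_image_of_injective _ hinj, Finset.card_univ, Fintype.card_fin] at h
  · -- a single block
    have h := mutualInfoOutput_le (P := P) (X := fun _ : Fin 1 => X) (fun _ => hX)
      (@iIndepFun.of_subsingleton _ _ _ _ _ _ _ _ _) (measurable_pi_apply 0) M
      fun _ _ _ => hM.donskerVaradhanLE hξ hρ Finset.univ _ _ fun j hj =>
        absurd (Finset.mem_univ j) hj
    simpa using h
  · -- `n` blocks of length one
    have h := mutualInfoOutput_le (P := P) (C := ξ + ρ) hX hind measurable_id M fun i x z => by
      simpa using hM.donskerVaradhanLE hξ hρ {i} x (Function.update x i z) fun j hj =>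
        (Function.update_of_ne (by simpa using hj) _ _).symm
    simpa [mul_comm] using h
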